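/- Let $\beta>0$, $\mathcal E>0$, $\mathcal N_0>0$ and $\gamma=\mathcal E/\mathcal N_0$. For positive integers $N$ and $K$ consider the channel $\boldsymbol y=\boldsymbol S\boldsymbol b+\boldsymbol n\in\mathbb C^N$, where - $\boldsymbol S=[\boldsymbol s_1,\dots,\boldsymbol s_K]\in\mathbb R^{N\times K}$ is a random time-hopping matrix with one pulse per symbol ($N_{\mathsf s}=1$): its columns are independent and uniformly distributed on the $2N$ vectors $\pm\boldsymbol e_1,\dots,\pm\boldsymbol e_N$, with $\boldsymbol e_i$ the standard basis vectors of $\mathbb R^N$; - the inputs $b_1,\dots,b_K$ are independent circularly symmetric complex Gaussian variables with mean $0$ and variance $\mathcal E$; - the coordinates of $\boldsymbol n$ are independent circularly symmetric complex Gaussian variables with mean $0$ and variance $\mathcal N_0$; - $\boldsymbol S,\boldsymbol b,\boldsymbol n$ are independent. A linear receiver forms $\boldsymbol r=\boldsymbol W^{\mathsf T}\boldsymbol y$, and the decoder of user $k$ observes $r_k$ and knows $\boldsymbol S$. The bank of decorrelators is $\boldsymbol W^{\mathsf T}=\boldsymbol S^{+}$ (the Moore–Penrose pseudoinverse), the bank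 of MMSE filters is $\boldsymbol W^{\mathsf T}=\boldsymbol W^{\mathsf T}(1/\gamma)$, where $\boldsymbol W^{\mathsf T}(\alpha)=(\boldsymbol S^{\mathsf T}\boldsymbol S+\alpha\boldsymbol I)^{-1}\boldsymbol S^{\mathsf T}$ for $\alpha>0$, and the bank of single-user matched filters is $\boldsymbol W^{\mathsf T}=\boldsymbol S^{\mathsf T}$. Let $I(b_k;r_k|\boldsymbol S)$ denote the conditional mutual information in bits. Then for the decorrelators, for the MMSE filters, for $\boldsymbol W^{\mathsf T}(\alpha)$ with any fixed $\alpha>0$, and for the single-user matched filters, in the large-system limit $N\to\infty$, $K/N\to\beta$, and for any choice of the user $k$ (in particular for user $1$), $$\beta\, I(b_k;r_k|\boldsymbol S)\;\longrightarrow\;\beta\sum_{j\ge 0}\frac{\beta^{j}e^{-\beta}}{j!}\,\log_2\!\Big(1+\frac{\gamma}{j\gamma+1}\Big),$$ where the series converges. In particular the limiting mutual information does not depend on $\alpha$ and is the same for decorrelators, MMSE filters and matched filters. -/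

import Mathlib

open MeasureTheory ProbabilityTheory Filter Topology
open scoped ENNReal NNReal Matrix

namespace THCDMA

/-! ### Moore–Penrose pseudoinverse of a real matrix -/

/-- `X` satisfies the four Penrose equations for `A`. -/
structure IsMoorePenroseInverse {N K : ℕ} (A : Matrix (Fin N) (Fin K) ℝ)
    (X : Matrix (Fin K) (Fin N) ℝ) : Prop where
  mul_mul_self : A * X * A = A
  self_mul_mul : X * A * X = X
  left_symm : (A * X)ᵀ = A * X
  right_symm : (X * A)ᵀ = X * A

theorem IsMoorePenroseInverse.unique {N K : ℕ} {A : Matrix (Fin N) (Fin K) ℝ}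
    {X Y : Matrix (Fin K) (Fin N) ℝ} (hX : IsMoorePenroseInverse A X)
    (hY : IsMoorePenroseInverse A Y) : X = Y := by
  have h1 : A * X = A * Y := by
    calc A * X = (A * Y) * (A * X) := by rw [← Matrix.mul_assoc, hY.mul_mul_self]
      _ = ((A * X) * (A * Y))ᵀ := by rw [Matrix.transpose_mul, hX.left_symm, hY.left_symm]
      _ = A * Y := by rw [← Matrix.mul_assoc, hX.mul_mul_self, hY.left_symm]
  have h2 : X * A = Y * A := by
    calc X * A = (X * A) * (Y * A) := by
          rw [Matrix.mul_assoc, ← Matrix.mul_assoc A Y A, hY.mul_mul_self]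
      _ = ((Y * A) * (X * A))ᵀ := by rw [Matrix.transpose_mul, hX.right_symm, hY.right_symm]
      _ = Y * A := by
          rw [Matrix.mul_assoc, ← Matrix.mul_assoc A X A, hX.mul_mul_self, hY.right_symm]
  calc X = X * A * X := hX.self_mul_mul.symm
    _ = X * A * Y := by rw [Matrix.mul_assoc, h1, ← Matrix.mul_assoc]
    _ = Y := by rw [h2, hY.self_mul_mul]

theorem exists_symmetric_pseudoinverse {K : ℕ} (H : Matrix (Fin K) (Fin K) ℝ)
    (hH : H.IsHermitian) :
    ∃ Y, Yᵀ = Y ∧ H * Y = Y * H ∧ H * Y * H = H ∧ Y * H * Y = Y := by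
  have h := hH.spectral_theorem
  rw [Unitary.conjStarAlgAut_apply] at h
  obtain ⟨V, hV⟩ : ∃ V : Matrix (Fin K) (Fin K) ℝ, V = hH.eigenvectorUnitary := ⟨_, rfl⟩
  have hVV : star V * V = 1 := by rw [hV]; exact Unitary.coe_star_mul_self _
  rw [← hV] at h
  set d := hH.eigenvalues
  have hs : (star V) = Vᵀ := by
    rw [Matrix.star_eq_conjTranspose, Matrix.conjTranspose_eq_transpose_of_trivial]
  rw [hs] at hVV
  have h' : H = V * Matrix.diagonal d * Vᵀ := by rw [← hs]; exact h
  have key : ∀ P Q : Matrix (Fin K) (Fin K) ℝ,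
      (V * P * Vᵀ) * (V * Q * Vᵀ) = V * (P * Q) * Vᵀ := by
    intro P Q
    calc _ = V * P * (Vᵀ * V) * Q * Vᵀ := by simp only [Matrix.mul_assoc]
      _ = _ := by rw [hVV]; simp only [Matrix.mul_assoc, Matrix.one_mul]
  refine ⟨V * Matrix.diagonal (fun i => (d i)⁻¹) * Vᵀ, ?_, ?_, ?_, ?_⟩
  · simp [Matrix.mul_assoc]
  · rw [h', key, key]; simp [mul_comm]
  · rw [h', key, key]; simp
  · have hd : ∀ i, (d i)⁻¹ * d i * (d i)⁻¹ = (d i)⁻¹ := fun i => by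
      by_cases hi : d i = 0 <;> simp [hi]
    rw [h', key, key]; simp [hd]

theorem exists_isMoorePenroseInverse {N K : ℕ} (A : Matrix (Fin N) (Fin K) ℝ) :
    ∃ X, IsMoorePenroseInverse A X := by
  have hH : (Aᵀ * A).IsHermitian := by
    simpa using Matrix.isHermitian_conjTranspose_mul_self A
  obtain ⟨Y, hY, hc, h1, h2⟩ := exists_symmetric_pseudoinverse _ hH
  have h3 : A * Y * (Aᵀ * A) = A := by
    have : A * Y * (Aᵀ * A) - A = 0 := by
      rw [← Matrix.conjTranspose_mul_self_eq_zero, Matrix.conjTranspose_eq_transpose_of_trivial]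
      have e : Aᵀ * (A * Y * (Aᵀ * A) - A) = 0 := by
        rw [Matrix.mul_sub, sub_eq_zero, ← h1]
        simp only [Matrix.mul_assoc] at h1 ⊢
        rw [h1]
        exact h1
      have e2 : (A * Y * (Aᵀ * A) - A)ᵀ = (Aᵀ * A * Y - 1) * Aᵀ := by
        simp [hY, Matrix.sub_mul, Matrix.mul_assoc]
      rw [e2, Matrix.mul_assoc, e, Matrix.mul_zero]
    exact sub_eq_zero.mp this
  refine ⟨Y * Aᵀ, ?_, ?_, ?_, ?_⟩
  · simpa only [Matrix.mul_assoc] using h3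
  · calc Y * Aᵀ * A * (Y * Aᵀ) = (Y * (Aᵀ * A) * Y) * Aᵀ := by simp only [Matrix.mul_assoc]
      _ = Y * Aᵀ := by rw [h2]
  · simp [hY, Matrix.mul_assoc]
  · rw [Matrix.mul_assoc, ← hc]; simp [hY, hc]

/-- The Moore–Penrose pseudoinverse `A⁺`. -/
noncomputable def pinv {N K : ℕ} (A : Matrix (Fin N) (Fin K) ℝ) : Matrix (Fin K) (Fin N) ℝ :=
  Classical.choose (exists_isMoorePenroseInverse A)

/-! ### Mutual information -/

/-- Mutual information `I(X;Y)` in bits: the Kullback–Leibler divergence of the joint law from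
the product of the marginals, divided by `log 2`. -/
noncomputable def mutualInfo {Ω 𝓧 𝓨 : Type*} [MeasurableSpace Ω] [MeasurableSpace 𝓧]
    [MeasurableSpace 𝓨] (X : Ω → 𝓧) (Y : Ω → 𝓨) (μ : Measure Ω) : ℝ≥0∞ :=
  InformationTheory.klDiv (μ.map fun ω => (X ω, Y ω)) ((μ.map X).prod (μ.map Y)) /
    ENNReal.ofReal (Real.log 2)

/-- Conditional mutual information `I(X;Y|Z) = ∑ z, P(Z = z) I(X;Y|Z = z)` in bits, for a
discrete random variable `Z` (one taking almost surely countably many values). -/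
noncomputable def condMutualInfo {Ω 𝓧 𝓨 𝓩 : Type*} [MeasurableSpace Ω] [MeasurableSpace 𝓧]
    [MeasurableSpace 𝓨] (X : Ω → 𝓧) (Y : Ω → 𝓨) (Z : Ω → 𝓩) (μ : Measure Ω) : ℝ≥0∞ :=
  ∑' z : 𝓩, μ {ω | Z ω = z} * mutualInfo X Y (μ[|{ω | Z ω = z}])

/-! ### The channel -/

/-- The circularly symmetric complex Gaussian law with mean zero and variance `v`: real and
imaginary parts are independent `N(0, v/2)`. -/
noncomputable def complexGaussian (v : ℝ≥0) : Measure ℂ :=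
  ((gaussianReal 0 (v / 2)).prod (gaussianReal 0 (v / 2))).map fun p => (⟨p.1, p.2⟩ : ℂ)

/-- The time-hopping sequences of length `N` with one pulse per symbol: exactly one entry is
nonzero, and it is `1` or `-1`. -/
def thSequences (N : ℕ) : Set (Fin N → ℝ) :=
  {s | ∃ i : Fin N, s = Pi.single i 1 ∨ s = Pi.single i (-1)}

/-- The random data of the channel `y = S b + n` with `K` users and `N` chips: the columns of
`S` are independent, uniformly distributed time-hopping sequences with one pulse; the inputs are
independent `CN(0, En)`; the noise coordinates are independent `CN(0, N₀)`; and `S`, `b`, `n`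
are independent. -/
structure IsTHChannel {Ω : Type*} [MeasurableSpace Ω] (μ : Measure Ω) {N K : ℕ} (En N₀ : ℝ≥0)
    (S : Ω → Matrix (Fin N) (Fin K) ℝ) (b : Ω → Fin K → ℂ) (n : Ω → Fin N → ℂ) : Prop where
  law_col : ∀ k, HasLaw (fun ω => (S ω).col k) (uniformOn (thSequences N)) μ
  indep_col : iIndepFun (fun k ω => (S ω).col k) μ
  law_input : HasLaw b (Measure.pi fun _ => complexGaussian En) μ
  law_noise : HasLaw n (Measure.pi fun _ => complexGaussian N₀) μ
  indep_input_noise : IndepFun b n μ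
  indep_spreading : IndepFun (fun ω k => (S ω).col k) (fun ω => (b ω, n ω)) μ

/-- Output of the channel `y = S b + n`. -/
noncomputable def received {N K : ℕ} (S : Matrix (Fin N) (Fin K) ℝ) (b : Fin K → ℂ)
    (n : Fin N → ℂ) : Fin N → ℂ :=
  S.map Complex.ofReal *ᵥ b + n

/-! ### Linear receivers

A receiver assigns to the spreading matrix `S` the matrix `Wᵀ` applied to the channel output. -/

/-- Bank of single-user matched filters, `Wᵀ = Sᵀ`. -/
def sumf {N K : ℕ} (S : Matrix (Fin N) (Fin K) ℝ) : Matrix (Fin K) (Fin N) ℝ := Sᵀ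

/-- Bank of decorrelators, `Wᵀ = S⁺`. -/
noncomputable def decorrelator {N K : ℕ} (S : Matrix (Fin N) (Fin K) ℝ) :
    Matrix (Fin K) (Fin N) ℝ := pinv S

/-- The regularized linear receiver `Wᵀ(α) = (Sᵀ S + α I)⁻¹ Sᵀ`. -/
noncomputable def linearReceiver {N K : ℕ} (α : ℝ) (S : Matrix (Fin N) (Fin K) ℝ) :
    Matrix (Fin K) (Fin N) ℝ := (Sᵀ * S + α • (1 : Matrix (Fin K) (Fin K) ℝ))⁻¹ * Sᵀ

/-- Bank of MMSE filters at signal-to-noise ratio `γ`, `Wᵀ = (Sᵀ S + γ⁻¹ I)⁻¹ Sᵀ`. -/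
noncomputable def mmse {N K : ℕ} (γ : ℝ) (S : Matrix (Fin N) (Fin K) ℝ) :
    Matrix (Fin K) (Fin N) ℝ := linearReceiver (1 / γ) S

/-- `I(b_k ; r_k | S)` in bits per channel use, where `r = Wᵀ y = Wᵀ (S b + n)`: the mutual
information of user `k` when the decoder of this user observes only `r_k` and knows `S`. -/
noncomputable def userInfo {Ω : Type*} [MeasurableSpace Ω] (μ : Measure Ω) {N K : ℕ}
    (W : Matrix (Fin N) (Fin K) ℝ → Matrix (Fin K) (Fin N) ℝ)
    (S : Ω → Matrix (Fin N) (Fin K) ℝ) (b : Ω → Fin K → ℂ) (n : Ω → Fin N → ℂ)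
    (k : Fin K) : ℝ≥0∞ :=
  condMutualInfo (fun ω => b ω k)
    (fun ω => ((W (S ω)).map Complex.ofReal *ᵥ received (S ω) (b ω) (n ω)) k) S μ

/-- The `k`-th term of the series in the limiting mutual information. -/
noncomputable def poissonTerm (β γ : ℝ) (k : ℕ) : ℝ :=
  β ^ k * Real.exp (-β) / (k.factorial : ℝ) * Real.logb 2 (1 + γ / (k * γ + 1))

end THCDMA

namespace THCDMA

/-! ### Complex Gaussian laws -/

/-! With one pulse per column, distinct rows of `S` have disjoint supports, so `S Sᵀ` is diagonal
and records how many pulses fall in each chip. The push-through identity then turns every receiver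
considered into `Sᵀ D` with `D` diagonal and nonzero on occupied chips. Since a signature lives on a
single chip, the filter of user `k` is a nonzero multiple of its signature (`IsMatchedUpToScale`),
and mutual information does not see the scale. This is why all receivers have the same limit,
already at finite `N`.

Given `S`, the output of such a filter is a scalar Gaussian channel. Squared cross-correlations are
`c²` or `0`, so with `j` other pulses in the same chip the rate is `log₂ (1 + γ / (jγ + 1))`. The
Gaussian mutual information comes from the explicit log-density of the joint law with respect to the
product of its marginals, whose mean needs only second moments.

Averaging over `S` makes `j` binomial with parameters `K - 1` and `1 / N`. Its weights converge to
Poisson weights of mean `β`; as the rates are bounded by `log₂ (1 + γ)`, dominated convergence for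
series gives the limit. -/

theorem complexGaussian_eq_map (v : ℝ≥0) :
    complexGaussian v = ((gaussianReal 0 (v / 2)).prod (gaussianReal 0 (v / 2))).map
      Complex.measurableEquivRealProd.symm := rfl

instance isProbabilityMeasure_complexGaussian (v : ℝ≥0) :
    IsProbabilityMeasure (complexGaussian v) := by
  rw [complexGaussian_eq_map]
  exact Measure.isProbabilityMeasure_map (MeasurableEquiv.measurable _).aemeasurable

/-- The density of `complexGaussian v` with respect to Lebesgue measure. -/
noncomputable def complexGaussianPDF (v : ℝ≥0) (z : ℂ) : ℝ :=
  (Real.pi * v)⁻¹ * Real.exp (-Complex.normSq z / v)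

theorem measurable_complexGaussianPDF (v : ℝ≥0) : Measurable (complexGaussianPDF v) := by
  have : Measurable Complex.normSq := Complex.continuous_normSq.measurable
  unfold complexGaussianPDF
  fun_prop

theorem complexGaussianPDF_pos {v : ℝ≥0} (hv : v ≠ 0) (z : ℂ) : 0 < complexGaussianPDF v z := by
  have : (0 : ℝ) < v := by positivity
  unfold complexGaussianPDF
  have := Real.pi_pos
  positivity

theorem gaussianPDFReal_mul_gaussianPDFReal (v : ℝ≥0) (x y : ℝ) :
    gaussianPDFReal 0 (v / 2) x * gaussianPDFReal 0 (v / 2) y =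
      complexGaussianPDF v ⟨x, y⟩ := by
  unfold gaussianPDFReal complexGaussianPDF
  have h : (2 * Real.pi * ((v / 2 : ℝ≥0) : ℝ)) = Real.pi * v := by push_cast; ring
  have h2 : 2 * ((v / 2 : ℝ≥0) : ℝ) = v := by push_cast; ring
  rw [h, h2, mul_mul_mul_comm, ← Real.exp_add, ← mul_inv,
    Real.mul_self_sqrt (by have := Real.pi_pos; positivity)]
  congr 2
  rw [Complex.normSq_mk]
  ring

theorem complexGaussian_eq_withDensity {v : ℝ≥0} (hv : v ≠ 0) :
    complexGaussian v = volume.withDensity (fun z => ENNReal.ofReal (complexGaussianPDF v z)) := by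
  have hv2 : v / 2 ≠ 0 := by positivity
  rw [complexGaussian_eq_map, gaussianReal_of_var_ne_zero _ hv2,
    prod_withDensity (measurable_gaussianPDF _ _) (measurable_gaussianPDF _ _)]
  refine Measure.ext_of_lintegral _ fun f hf => ?_
  have hp : Measurable fun z => ENNReal.ofReal (complexGaussianPDF v z) :=
    (measurable_complexGaussianPDF v).ennreal_ofReal
  have hm := Complex.volume_preserving_equiv_real_prod.symm
  rw [lintegral_map hf (MeasurableEquiv.measurable _),
    lintegral_withDensity_eq_lintegral_mul _ (by fun_prop) (by fun_prop),
    lintegral_withDensity_eq_lintegral_mul _ hp hf,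
    ← hm.lintegral_comp (hp.mul hf), ← Measure.volume_eq_prod]
  refine lintegral_congr fun p => ?_
  simp only [Pi.mul_apply, gaussianPDF, Complex.measurableEquivRealProd_symm_apply]
  rw [← ENNReal.ofReal_mul (gaussianPDFReal_nonneg _ _ _), gaussianPDFReal_mul_gaussianPDFReal]

/-- The independent real and imaginary parts factor the integral. The exponent is linear in `v` and
in `|t|²`, so scalings and independent sums of these laws reduce to comparing exponents. -/
theorem charFun_complexGaussian (v : ℝ≥0) (t : ℂ) :
    charFun (complexGaussian v) t = Complex.exp (-(v * Complex.normSq t / 4 : ℝ)) := by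
  rw [complexGaussian_eq_map, charFun_apply, integral_map_equiv]
  have h : ∀ p : ℝ × ℝ, Complex.exp (((inner ℝ (Complex.measurableEquivRealProd.symm p) t : ℝ) : ℂ)
      * Complex.I) = Complex.exp ((inner ℝ p.1 t.re : ℝ) * Complex.I) *
        Complex.exp ((inner ℝ p.2 t.im : ℝ) * Complex.I) := by
    intro p
    rw [← Complex.exp_add]
    congr 1
    simp [Complex.inner]
    ring
  simp_rw [h]
  rw [integral_prod_mul (fun x : ℝ => Complex.exp ((inner ℝ x t.re : ℝ) * Complex.I))
    (fun x : ℝ => Complex.exp ((inner ℝ x t.im : ℝ) * Complex.I)), ← charFun_apply,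
    ← charFun_apply, charFun_gaussianReal, charFun_gaussianReal, ← Complex.exp_add]
  congr 1
  rw [Complex.normSq_apply]
  push_cast
  ring

theorem complexGaussian_map_real_mul (v : ℝ≥0) (a : ℝ) :
    (complexGaussian v).map (fun z => (a : ℂ) * z) = complexGaussian (a.nnabs ^ 2 * v) := by
  have : IsProbabilityMeasure ((complexGaussian v).map (fun z => (a : ℂ) * z)) :=
    Measure.isProbabilityMeasure_map (by fun_prop)
  refine Measure.ext_of_charFun (funext fun t => ?_)
  have h : (fun z : ℂ => (a : ℂ) * z) = (a • ·) := by ext z; simp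
  rw [h, charFun_map_smul, charFun_complexGaussian, charFun_complexGaussian]
  congr 2
  simp [Complex.normSq_mul]
  ring

theorem complexGaussian_prod_map_add (v w : ℝ≥0) :
    ((complexGaussian v).prod (complexGaussian w)).map (fun p => p.1 + p.2) =
      complexGaussian (v + w) := by
  have : IsProbabilityMeasure
      (((complexGaussian v).prod (complexGaussian w)).map (fun p : ℂ × ℂ => p.1 + p.2)) :=
    Measure.isProbabilityMeasure_map (by fun_prop)
  refine Measure.ext_of_charFun (funext fun t => ?_)
  rw [charFun_map_add_prod_eq_mul, Pi.mul_apply, charFun_complexGaussian, charFun_complexGaussian,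
    charFun_complexGaussian, ← Complex.exp_add]
  congr 1
  push_cast
  ring

theorem pi_complexGaussian_map_sum {ι : Type*} [Fintype ι] (v : ℝ≥0) (a : ι → ℝ) :
    (Measure.pi fun _ : ι => complexGaussian v).map (fun b => ∑ j, (a j : ℂ) * b j) =
      complexGaussian (v * ∑ j, (a j).nnabs ^ 2) := by
  have : IsProbabilityMeasure
      ((Measure.pi fun _ : ι => complexGaussian v).map (fun b => ∑ j, (a j : ℂ) * b j)) :=
    Measure.isProbabilityMeasure_map (Measurable.aemeasurable (by fun_prop))
  refine Measure.ext_of_charFun (funext fun t => ?_)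
  have h := charFun_map_sum_pi_eq_prod (fun j : ι => complexGaussian ((a j).nnabs ^ 2 * v))
  -- Absorbing the coefficients into the variances leaves a plain sum of independent coordinates, to
  -- which the product formula for characteristic functions applies.
  have e : (Measure.pi fun j : ι => complexGaussian ((a j).nnabs ^ 2 * v)) =
      (Measure.pi fun _ : ι => complexGaussian v).map (fun b j => (a j : ℂ) * b j) := by
    simp_rw [← complexGaussian_map_real_mul]
    have (j : ι) : IsProbabilityMeasure ((complexGaussian v).map (fun z => (a j : ℂ) * z)) :=
      Measure.isProbabilityMeasure_map (by fun_prop)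
    rw [Measure.pi_map_pi (fun _ => by fun_prop)]
  rw [e, Measure.map_map (by fun_prop) (by fun_prop)] at h
  have h' := congrFun h t
  simp only [Function.comp_def] at h'
  rw [h', Finset.prod_apply]
  simp_rw [charFun_complexGaussian]
  rw [← Complex.exp_sum]
  congr 1
  push_cast
  rw [Finset.mul_sum, Finset.sum_mul, Finset.sum_div, ← Finset.sum_neg_distrib]
  refine Finset.sum_congr rfl fun j _ => ?_
  ring

theorem integrable_normSq_complexGaussian (v : ℝ≥0) :
    Integrable (fun z => Complex.normSq z) (complexGaussian v) := by
  have h : Integrable (fun x : ℝ => x ^ 2) (gaussianReal 0 (v / 2)) :=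
    (memLp_id_gaussianReal 2).integrable_sq
  rw [complexGaussian_eq_map, integrable_map_equiv]
  refine ((h.comp_fst (gaussianReal 0 (v / 2))).add
    (h.comp_snd (gaussianReal 0 (v / 2)))).congr (ae_of_all _ fun p => ?_)
  simp [Complex.normSq_mk, pow_two]

theorem integral_normSq_complexGaussian (v : ℝ≥0) :
    ∫ z, Complex.normSq z ∂(complexGaussian v) = v := by
  have h : Integrable (fun x : ℝ => x ^ 2) (gaussianReal 0 (v / 2)) :=
    (memLp_id_gaussianReal 2).integrable_sq
  have h2 : ∫ x : ℝ, x ^ 2 ∂(gaussianReal 0 (v / 2)) = v / 2 := by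
    have := variance_fun_id_gaussianReal (μ := 0) (v := v / 2)
    rw [variance_eq_integral measurable_id'.aemeasurable] at this
    simpa using this
  rw [complexGaussian_eq_map, integral_map_equiv]
  have e : ∀ p : ℝ × ℝ, Complex.normSq (Complex.measurableEquivRealProd.symm p) =
      p.1 ^ 2 + p.2 ^ 2 := fun p => by simp [Complex.normSq_mk, pow_two]
  simp_rw [e]
  rw [integral_add (h.comp_fst _) (h.comp_snd _), integral_fun_fst (fun x : ℝ => x ^ 2),
    integral_fun_snd (fun x : ℝ => x ^ 2), h2]
  simp

/-! ### Mutual information of a complex Gaussian channel -/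

/-- The log-likelihood ratio is `g` almost everywhere, and the total-mass correction in `klDiv`
cancels for probability measures. -/
theorem klDiv_withDensity_exp {α : Type*} [MeasurableSpace α] {μ ν : Measure α}
    [IsProbabilityMeasure μ] [IsProbabilityMeasure ν] {g : α → ℝ} (hg : Measurable g)
    (h : μ = ν.withDensity (fun x => ENNReal.ofReal (Real.exp (g x)))) (hi : Integrable g μ) :
    InformationTheory.klDiv μ ν = ENNReal.ofReal (∫ x, g x ∂μ) := by
  have hac : μ ≪ ν := h ▸ withDensity_absolutelyContinuous _ _
  have hr : μ.rnDeriv ν =ᵐ[ν] fun x => ENNReal.ofReal (Real.exp (g x)) := by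
    rw [h]
    exact Measure.rnDeriv_withDensity _ (by fun_prop)
  have hl : llr μ ν =ᵐ[μ] g := by
    filter_upwards [hac.ae_le hr] with x hx
    rw [llr, hx, ENNReal.toReal_ofReal (Real.exp_pos _).le, Real.log_exp]
  rw [InformationTheory.klDiv_of_ac_of_integrable hac (hi.congr hl.symm), integral_congr_ae hl]
  simp

/-- The log-likelihood ratio of the additive channel `Y = c X + Z` with `Z ~ CN(0, w)` against
the output law `CN(0, v)`. -/
noncomputable def channelLogRatio (c : ℝ) (v w : ℝ≥0) (p : ℂ × ℂ) : ℝ :=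
  Real.log (v / w) - Complex.normSq (p.2 - c * p.1) / w + Complex.normSq p.2 / v

theorem measurable_channelLogRatio (c : ℝ) (v w : ℝ≥0) : Measurable (channelLogRatio c v w) := by
  have : Measurable Complex.normSq := Complex.continuous_normSq.measurable
  unfold channelLogRatio
  fun_prop

theorem complexGaussianPDF_sub_eq {v w : ℝ≥0} (hv : v ≠ 0) (hw : w ≠ 0) (c : ℝ) (x y : ℂ) :
    complexGaussianPDF w (y - c * x) =
      complexGaussianPDF v y * Real.exp (channelLogRatio c v w (x, y)) := by
  have hv' : (0 : ℝ) < v := by positivity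
  have hw' : (0 : ℝ) < w := by positivity
  unfold complexGaussianPDF channelLogRatio
  rw [Real.exp_add, Real.exp_sub, Real.exp_log (by positivity), neg_div, Real.exp_neg, neg_div,
    Real.exp_neg]
  have := Real.pi_pos
  have := Real.exp_pos (Complex.normSq y / v)
  field_simp

/-- The law of `(X, c X + Z)` for independent `X ~ CN(0, e)` and `Z ~ CN(0, w)`. -/
noncomputable def channelLaw (e : ℝ≥0) (c : ℝ) (w : ℝ≥0) : Measure (ℂ × ℂ) :=
  ((complexGaussian e).prod (complexGaussian w)).map (fun p => (p.1, c * p.1 + p.2))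

instance isProbabilityMeasure_channelLaw (e : ℝ≥0) (c : ℝ) (w : ℝ≥0) :
    IsProbabilityMeasure (channelLaw e c w) :=
  Measure.isProbabilityMeasure_map (by fun_prop)

theorem channelLaw_map_fst (e : ℝ≥0) (c : ℝ) (w : ℝ≥0) :
    (channelLaw e c w).map Prod.fst = complexGaussian e := by
  rw [channelLaw, Measure.map_map (by fun_prop) (by fun_prop)]
  exact Measure.fst_prod

theorem channelLaw_map_snd (e : ℝ≥0) (c : ℝ) (w : ℝ≥0) :
    (channelLaw e c w).map Prod.snd = complexGaussian (c.nnabs ^ 2 * e + w) := by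
  rw [channelLaw, Measure.map_map (by fun_prop) (by fun_prop), ← complexGaussian_prod_map_add,
    ← complexGaussian_map_real_mul]
  nth_rewrite 2 [← Measure.map_id (μ := complexGaussian w)]
  rw [Measure.map_prod_map _ _ (by fun_prop) (by fun_prop),
    Measure.map_map (by fun_prop) (by fun_prop)]
  rfl

theorem channelLaw_eq_withDensity (e : ℝ≥0) (c : ℝ) {w : ℝ≥0} (hw : w ≠ 0) :
    channelLaw e c w =
      ((complexGaussian e).prod (complexGaussian (c.nnabs ^ 2 * e + w))).withDensity
        (fun p => ENNReal.ofReal (Real.exp (channelLogRatio c (c.nnabs ^ 2 * e + w) w p))) := by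
  set v := c.nnabs ^ 2 * e + w with hv
  have hv0 : v ≠ 0 := by positivity
  have hg := measurable_channelLogRatio c v w
  have hpv := (measurable_complexGaussianPDF v).ennreal_ofReal
  have hpw := (measurable_complexGaussianPDF w).ennreal_ofReal
  refine Measure.ext_of_lintegral _ fun f hf => ?_
  rw [channelLaw, lintegral_map hf (by fun_prop), lintegral_prod _ (by fun_prop),
    lintegral_withDensity_eq_lintegral_mul _ (by fun_prop) hf, lintegral_prod _ (by fun_prop)]
  refine lintegral_congr fun x => ?_
  rw [complexGaussian_eq_withDensity hw, complexGaussian_eq_withDensity hv0,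
    lintegral_withDensity_eq_lintegral_mul _ hpw (by fun_prop),
    lintegral_withDensity_eq_lintegral_mul _ hpv (by fun_prop),
    -- Translation invariance of Lebesgue measure changes the variable from the noise to the output
    -- `y`.
    ← lintegral_sub_right_eq_self _ ((c : ℂ) * x)]
  refine lintegral_congr fun y => ?_
  simp only [Pi.mul_apply, add_sub_cancel]
  rw [complexGaussianPDF_sub_eq hv0 hw, ENNReal.ofReal_mul (complexGaussianPDF_pos hv0 _).le,
    mul_assoc]

/-- `Y - cX` has variance `w` and `Y` has variance `v`, so the two quadratic terms have means `-1`
and `1` and cancel, leaving `log (v / w)`. -/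
theorem integral_channelLogRatio (e : ℝ≥0) (c : ℝ) {w : ℝ≥0} (hw : w ≠ 0) :
    Integrable (channelLogRatio c (c.nnabs ^ 2 * e + w) w) (channelLaw e c w) ∧
    ∫ p, channelLogRatio c (c.nnabs ^ 2 * e + w) w p ∂(channelLaw e c w) =
      Real.log (1 + c ^ 2 * e / w) := by
  set v := c.nnabs ^ 2 * e + w with hv
  have hv0 : (v : ℝ) ≠ 0 := by positivity
  have hw0 : (w : ℝ) ≠ 0 := by positivity
  have hn : Measurable Complex.normSq := Complex.continuous_normSq.measurable
  have hsnd : (channelLaw e c w).map Prod.snd = complexGaussian v := channelLaw_map_snd e c w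
  have hnoise : (channelLaw e c w).map (fun p : ℂ × ℂ => p.2 - (c : ℂ) * p.1) = complexGaussian w := by
    rw [channelLaw, Measure.map_map (by fun_prop) (by fun_prop)]
    simp only [Function.comp_def, add_sub_cancel_left]
    exact Measure.snd_prod
  have i1 : Integrable (fun p : ℂ × ℂ => Complex.normSq p.2) (channelLaw e c w) := by
    have := integrable_normSq_complexGaussian v
    rw [← hsnd] at this
    exact this.comp_measurable measurable_snd
  have i2 : Integrable (fun p : ℂ × ℂ => Complex.normSq (p.2 - c * p.1)) (channelLaw e c w) := by
    have := integrable_normSq_complexGaussian w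
    rw [← hnoise] at this
    exact this.comp_measurable (by fun_prop)
  have e1 : ∫ p, Complex.normSq p.2 ∂(channelLaw e c w) = v := by
    have := integral_normSq_complexGaussian v
    rwa [← hsnd, integral_map (by fun_prop) (by fun_prop)] at this
  have e2 : ∫ p, Complex.normSq (p.2 - c * p.1) ∂(channelLaw e c w) = w := by
    have := integral_normSq_complexGaussian w
    rwa [← hnoise, integral_map (by fun_prop) (by fun_prop)] at this
  unfold channelLogRatio
  refine ⟨((integrable_const _).sub (i2.div_const _)).add (i1.div_const _), ?_⟩
  rw [integral_add (f := fun p : ℂ × ℂ => Real.log (v / w) - Complex.normSq (p.2 - c * p.1) / w)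
      ((integrable_const _).sub (i2.div_const _)) (i1.div_const _),
    integral_sub (integrable_const _) (i2.div_const _), integral_div, integral_div, e1, e2,
    div_self hv0, div_self hw0]
  simp only [integral_const, probReal_univ, smul_eq_mul, one_mul, sub_add_cancel]
  congr 1
  rw [hv]
  push_cast
  rw [sq_abs]
  field_simp
  ring

theorem klDiv_channelLaw (e : ℝ≥0) (c : ℝ) {w : ℝ≥0} (hw : w ≠ 0) :
    InformationTheory.klDiv (channelLaw e c w)
      (((channelLaw e c w).map Prod.fst).prod ((channelLaw e c w).map Prod.snd)) =
      ENNReal.ofReal (Real.log (1 + c ^ 2 * e / w)) := by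
  rw [channelLaw_map_fst, channelLaw_map_snd]
  obtain ⟨hi, he⟩ := integral_channelLogRatio e c hw
  rw [klDiv_withDensity_exp (measurable_channelLogRatio _ _ _)
    (channelLaw_eq_withDensity e c hw) hi, he]

theorem mutualInfo_of_map_eq_channelLaw {Ω : Type*} [MeasurableSpace Ω] {μ : Measure Ω}
    {X Y : Ω → ℂ} (hX : AEMeasurable X μ) (hY : AEMeasurable Y μ) {e : ℝ≥0} {c : ℝ} {w : ℝ≥0}
    (hw : w ≠ 0) (h : μ.map (fun ω => (X ω, Y ω)) = channelLaw e c w) :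
    mutualInfo X Y μ = ENNReal.ofReal (Real.logb 2 (1 + c ^ 2 * e / w)) := by
  have h1 : μ.map X = (channelLaw e c w).map Prod.fst := by
    rw [← h, AEMeasurable.map_map_of_aemeasurable (by fun_prop) (hX.prodMk hY)]; rfl
  have h2 : μ.map Y = (channelLaw e c w).map Prod.snd := by
    rw [← h, AEMeasurable.map_map_of_aemeasurable (by fun_prop) (hX.prodMk hY)]; rfl
  rw [mutualInfo, h, h1, h2, klDiv_channelLaw e c hw, Real.logb,
    ENNReal.ofReal_div_of_pos (Real.log_pos one_lt_two)]

/-- A linear statistic of one distinguished input, the remaining inputs and the noise is a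
Gaussian channel for the distinguished input. -/
theorem map_linear_statistic_eq_channelLaw {M N : ℕ} (e v : ℝ≥0) (u : Fin (M + 1))
    (a : Fin (M + 1) → ℝ) (w : Fin N → ℝ) :
    ((Measure.pi fun _ : Fin (M + 1) => complexGaussian e).prod
        (Measure.pi fun _ : Fin N => complexGaussian v)).map
      (fun q => (q.1 u, ∑ j, (a j : ℂ) * q.1 j + ∑ i, (w i : ℂ) * q.2 i)) =
    channelLaw e (a u)
      (e * ∑ j, (a (u.succAbove j)).nnabs ^ 2 + v * ∑ i, (w i).nnabs ^ 2) := by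
  have hp := (measurePreserving_piFinSuccAbove
    (fun _ : Fin (M + 1) => complexGaussian e) u).symm
  have h1 : Measurable (fun b : Fin M → ℂ => ∑ j, (a (u.succAbove j) : ℂ) * b j) := by fun_prop
  have h2 : Measurable (fun b : Fin N → ℂ => ∑ j, (w j : ℂ) * b j) := by fun_prop
  rw [channelLaw, ← complexGaussian_prod_map_add, ← pi_complexGaussian_map_sum,
    ← pi_complexGaussian_map_sum, Measure.map_prod_map _ _ h1 h2,
    Measure.map_map (by fun_prop) (by fun_prop)]
  nth_rewrite 2 [← Measure.map_id (μ := complexGaussian e)]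
  rw [Measure.map_prod_map _ _ (by fun_prop) (by fun_prop),
    Measure.map_map (by fun_prop) (by fun_prop), ← Measure.prodAssoc_prod,
    Measure.map_map (by fun_prop) (by fun_prop), ← hp.map_eq]
  nth_rewrite 1 [← Measure.map_id (μ := Measure.pi fun _ : Fin N => complexGaussian v)]
  rw [Measure.map_prod_map _ _ (by fun_prop) (by fun_prop),
    Measure.map_map (by fun_prop) (by fun_prop)]
  congr 1
  have ha : ∀ (x : ℂ) (b : Fin M → ℂ) (n : Fin N → ℂ),
      MeasurableEquiv.prodAssoc ((x, b), n) = (x, b, n) := fun _ _ _ => rfl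
  ext ⟨⟨x, b⟩, n⟩
  · simp [ha]
  · simp [ha, Fin.sum_univ_succAbove _ u, add_assoc]

/-! ### Time-hopping matrices -/

/-- The time-hopping sequence with its pulse at `q.1` and polarity `q.2`. -/
def thSeq {N : ℕ} (q : Fin N × Bool) : Fin N → ℝ := Pi.single q.1 (if q.2 then 1 else -1)

theorem thSeq_self {N : ℕ} (q : Fin N × Bool) : thSeq q q.1 = if q.2 then 1 else -1 := by
  simp [thSeq]

theorem thSeq_of_ne {N : ℕ} {q : Fin N × Bool} {i : Fin N} (h : i ≠ q.1) : thSeq q i = 0 := by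
  simp [thSeq, h]

theorem thSeq_self_sq {N : ℕ} (q : Fin N × Bool) : thSeq q q.1 ^ 2 = 1 := by
  rw [thSeq_self]; split_ifs <;> norm_num

theorem thSeq_injective {N : ℕ} : Function.Injective (thSeq (N := N)) := by
  rintro ⟨i, s⟩ ⟨j, t⟩ h
  have hij : i = j := by
    by_contra hne
    have h1 := thSeq_self_sq (i, s)
    rw [h, thSeq_of_ne hne] at h1
    norm_num at h1
  subst hij
  have h1 := congrFun h i
  rw [thSeq_self (i, s), thSeq_self (i, t)] at h1
  cases s <;> cases t <;> first | rfl | (norm_num at h1)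

theorem range_thSeq (N : ℕ) : Set.range (thSeq (N := N)) = thSequences N := by
  ext s
  constructor
  · rintro ⟨⟨i, t⟩, rfl⟩
    refine ⟨i, ?_⟩
    cases t <;> simp [thSeq]
  · rintro ⟨i, h | h⟩
    · exact ⟨(i, true), by simp [thSeq, h]⟩
    · exact ⟨(i, false), by simp [thSeq, h]⟩

/-- The matrix whose columns are the given time-hopping sequences. -/
def thMatrix {N K : ℕ} (p : Fin K → Fin N × Bool) : Matrix (Fin N) (Fin K) ℝ :=
  Matrix.of fun i k => thSeq (p k) i

theorem thMatrix_apply {N K : ℕ} (p : Fin K → Fin N × Bool) (i : Fin N) (k : Fin K) :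
    thMatrix p i k = thSeq (p k) i := rfl

theorem thMatrix_col {N K : ℕ} (p : Fin K → Fin N × Bool) (k : Fin K) :
    (thMatrix p).col k = thSeq (p k) := rfl

theorem thMatrix_injective {N K : ℕ} : Function.Injective (thMatrix (N := N) (K := K)) := by
  intro p q h
  funext k
  exact thSeq_injective (congrArg (fun A : Matrix _ _ ℝ => A.col k) h)

theorem mem_range_thMatrix {N K : ℕ} {z : Matrix (Fin N) (Fin K) ℝ}
    (h : ∀ k, z.col k ∈ thSequences N) : z ∈ Set.range (thMatrix (N := N) (K := K)) := by
  simp_rw [← range_thSeq] at h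
  choose p hp using h
  refine ⟨p, ?_⟩
  ext i k
  exact congrFun (hp k) i

theorem uniformOn_thSequences_singleton {N : ℕ} (q : Fin N × Bool) :
    uniformOn (thSequences N) {thSeq q} = ((2 * N : ℕ) : ℝ≥0∞)⁻¹ := by
  classical
  have h : thSequences N = ((Finset.univ.image (thSeq (N := N)) : Finset _) : Set _) := by
    rw [← range_thSeq]; simp
  rw [h, ← Finset.coe_singleton, uniformOn_apply_finset,
    Finset.inter_singleton_of_mem (Finset.mem_image_of_mem _ (Finset.mem_univ _)),
    Finset.card_image_of_injective _ thSeq_injective]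
  simp [mul_comm]

theorem uniformOn_thSequences_singleton_of_notMem {N : ℕ} {s : Fin N → ℝ}
    (hs : s ∉ thSequences N) : uniformOn (thSequences N) {s} = 0 := by
  have hf : (thSequences N).Finite := by
    rw [← range_thSeq]; exact Set.finite_range _
  rw [uniformOn_eq_zero_iff hf]
  simpa using hs

/-! ### Receivers on time-hopping matrices -/

/-- The number of pulses in each chip. -/
def chipLoad {N K : ℕ} (p : Fin K → Fin N × Bool) (i : Fin N) : ℝ :=
  ∑ k, thMatrix p i k ^ 2

theorem chipLoad_nonneg {N K : ℕ} (p : Fin K → Fin N × Bool) (i : Fin N) : 0 ≤ chipLoad p i :=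
  Finset.sum_nonneg fun _ _ => sq_nonneg _

theorem chipLoad_pos {N K : ℕ} {p : Fin K → Fin N × Bool} {i : Fin N} {k : Fin K}
    (h : thMatrix p i k ≠ 0) : 0 < chipLoad p i :=
  Finset.sum_pos' (fun _ _ => sq_nonneg _) ⟨k, Finset.mem_univ _, by positivity⟩

/-- No column has two nonzero entries, so products across different rows vanish. This is the
structural fact that makes the receivers explicit. -/
theorem thMatrix_mul_transpose {N K : ℕ} (p : Fin K → Fin N × Bool) :
    thMatrix p * (thMatrix p)ᵀ = Matrix.diagonal (chipLoad p) := by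
  ext i j
  rw [Matrix.mul_apply]
  by_cases hij : i = j
  · subst hij
    simp [chipLoad, pow_two]
  · rw [Matrix.diagonal_apply_ne _ hij]
    refine Finset.sum_eq_zero fun k _ => ?_
    rw [Matrix.transpose_apply, thMatrix_apply, thMatrix_apply]
    by_cases hi : i = (p k).1
    · rw [thSeq_of_ne (i := j) (by rintro rfl; exact hij hi), mul_zero]
    · rw [thSeq_of_ne hi, zero_mul]

/-- A receiver whose `k`-th filter is a nonzero multiple of the signature of user `k`, whenever
the spreading matrix consists of time-hopping sequences. -/
def IsMatchedUpToScale {N K : ℕ}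
    (W : Matrix (Fin N) (Fin K) ℝ → Matrix (Fin K) (Fin N) ℝ) : Prop :=
  ∀ (p : Fin K → Fin N × Bool) (k : Fin K), ∃ c : ℝ, c ≠ 0 ∧
    ∀ i, W (thMatrix p) k i = c * thSeq (p k) i

theorem isMatchedUpToScale_sumf {N K : ℕ} :
    IsMatchedUpToScale (sumf (N := N) (K := K)) := fun _ _ =>
  ⟨1, one_ne_zero, fun _ => (one_mul _).symm⟩

/-- A signature supported on one chip is merely scaled by the diagonal entry there. Nonvanishing is
asked only on occupied chips because the decorrelator has zero entries at empty ones. -/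
theorem exists_scale_of_eq_transpose_mul_diagonal {N K : ℕ} (p : Fin K → Fin N × Bool)
    {d : Fin N → ℝ} (hd : ∀ i, 0 < chipLoad p i → d i ≠ 0) (k : Fin K) :
    ∃ c : ℝ, c ≠ 0 ∧
      ∀ i, ((thMatrix p)ᵀ * Matrix.diagonal d) k i = c * thSeq (p k) i := by
  refine ⟨d (p k).1, hd _ (chipLoad_pos (k := k) ?_), fun i => ?_⟩
  · rw [thMatrix_apply]
    have := thSeq_self_sq (p k)
    intro h
    rw [h] at this
    norm_num at this
  · rw [Matrix.mul_diagonal, Matrix.transpose_apply, thMatrix_apply]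
    by_cases hi : i = (p k).1
    · rw [hi, mul_comm]
    · rw [thSeq_of_ne hi, zero_mul, mul_zero]

/-- Push-through: `(AᵀA + αI) Aᵀ = Aᵀ (AAᵀ + αI)`, and the right-hand factor is diagonal. Positive
definiteness, from `0 < α`, allows the inverse to be cancelled. -/
theorem linearReceiver_thMatrix {N K : ℕ} {α : ℝ} (hα : 0 < α) (p : Fin K → Fin N × Bool) :
    linearReceiver α (thMatrix p) =
      (thMatrix p)ᵀ * Matrix.diagonal (fun i => (chipLoad p i + α)⁻¹) := by
  set A := thMatrix p
  have hpd : (Aᵀ * A + α • (1 : Matrix (Fin K) (Fin K) ℝ)).PosDef := by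
    have h1 : (Aᵀ * A).PosSemidef := by
      simpa using Matrix.posSemidef_conjTranspose_mul_self A
    exact Matrix.PosDef.posSemidef_add h1 (Matrix.PosDef.one.smul hα)
  have hu : IsUnit (Aᵀ * A + α • (1 : Matrix (Fin K) (Fin K) ℝ)).det :=
    (Matrix.isUnit_iff_isUnit_det _).mp hpd.isUnit
  have hd : (A * Aᵀ + α • (1 : Matrix (Fin N) (Fin N) ℝ)) *
      Matrix.diagonal (fun i => (chipLoad p i + α)⁻¹) = 1 := by
    rw [thMatrix_mul_transpose, ← Matrix.diagonal_one, ← Matrix.diagonal_smul,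
      Matrix.diagonal_add, Matrix.diagonal_mul_diagonal]
    congr 1
    funext i
    have := chipLoad_nonneg p i
    simp only [Pi.smul_apply, smul_eq_mul, mul_one]
    exact mul_inv_cancel₀ (by positivity)
  have hc : (Aᵀ * A + α • (1 : Matrix (Fin K) (Fin K) ℝ)) *
      (Aᵀ * Matrix.diagonal (fun i => (chipLoad p i + α)⁻¹)) = Aᵀ := by
    calc _ = Aᵀ * ((A * Aᵀ + α • (1 : Matrix (Fin N) (Fin N) ℝ)) *
          Matrix.diagonal (fun i => (chipLoad p i + α)⁻¹)) := by
          simp only [Matrix.add_mul, Matrix.mul_add, Matrix.mul_assoc, Matrix.smul_mul,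
            Matrix.mul_smul, Matrix.one_mul]
      _ = Aᵀ := by rw [hd, Matrix.mul_one]
  rw [linearReceiver]
  nth_rewrite 2 [← hc]
  rw [Matrix.nonsing_inv_mul_cancel_left _ _ hu]

theorem isMatchedUpToScale_linearReceiver {N K : ℕ} {α : ℝ} (hα : 0 < α) :
    IsMatchedUpToScale (linearReceiver (N := N) (K := K) α) := by
  intro p k
  rw [linearReceiver_thMatrix hα]
  refine exists_scale_of_eq_transpose_mul_diagonal p (fun i _ => ?_) k
  have := chipLoad_nonneg p i
  positivity

/-- With the convention `0⁻¹ = 0`, inverting the loads entrywise makes `A X` the projection onto the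
occupied chips, and every column of `A` lies in its range. -/
theorem isMoorePenroseInverse_thMatrix {N K : ℕ} (p : Fin K → Fin N × Bool) :
    IsMoorePenroseInverse (thMatrix p)
      ((thMatrix p)ᵀ * Matrix.diagonal (fun i => (chipLoad p i)⁻¹)) := by
  have hAX : thMatrix p * ((thMatrix p)ᵀ * Matrix.diagonal (fun i => (chipLoad p i)⁻¹)) =
      Matrix.diagonal (fun i => chipLoad p i * (chipLoad p i)⁻¹) := by
    rw [← Matrix.mul_assoc, thMatrix_mul_transpose, Matrix.diagonal_mul_diagonal]
  refine ⟨?_, ?_, ?_, ?_⟩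
  · rw [hAX]
    ext i k
    rw [Matrix.diagonal_mul]
    by_cases h : thMatrix p i k = 0
    · rw [h, mul_zero]
    · rw [mul_inv_cancel₀ (chipLoad_pos h).ne', one_mul]
  · rw [Matrix.mul_assoc, hAX, Matrix.mul_assoc, Matrix.diagonal_mul_diagonal]
    congr 2
    funext i
    by_cases h : chipLoad p i = 0
    · simp [h]
    · field_simp
  · rw [hAX, Matrix.diagonal_transpose]
  · simp [Matrix.mul_assoc]

theorem isMatchedUpToScale_decorrelator {N K : ℕ} :
    IsMatchedUpToScale (decorrelator (N := N) (K := K)) := by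
  intro p k
  have h : decorrelator (thMatrix p) =
      (thMatrix p)ᵀ * Matrix.diagonal (fun i => (chipLoad p i)⁻¹) :=
    IsMoorePenroseInverse.unique (Classical.choose_spec (exists_isMoorePenroseInverse _))
      (isMoorePenroseInverse_thMatrix p)
  rw [h]
  exact exists_scale_of_eq_transpose_mul_diagonal p (fun i hi => inv_ne_zero hi.ne') k

/-! ### The channel conditioned on the spreading matrix -/

theorem setOf_eq_preimage_cols {Ω : Type*} {N K : ℕ}
    (S : Ω → Matrix (Fin N) (Fin K) ℝ) (z : Matrix (Fin N) (Fin K) ℝ) :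
    {ω | S ω = z} = (fun ω k => (S ω).col k) ⁻¹' {fun k => z.col k} := by
  ext ω
  simp only [Set.mem_ofPred_eq, Set.mem_preimage, Set.mem_singleton_iff]
  refine ⟨fun h => by rw [h], fun h => ?_⟩
  ext i k
  exact congrFun (congrFun h k) i

section Channel

variable {Ω : Type*} [MeasurableSpace Ω] {μ : Measure Ω} {N K : ℕ}
  {En N₀ : ℝ≥0} {S : Ω → Matrix (Fin N) (Fin K) ℝ} {b : Ω → Fin K → ℂ} {n : Ω → Fin N → ℂ}

theorem IsTHChannel.aemeasurable_cols (h : IsTHChannel μ En N₀ S b n) :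
    AEMeasurable (fun ω k => (S ω).col k) μ :=
  aemeasurable_pi_lambda _ fun k => (h.law_col k).aemeasurable

theorem IsTHChannel.nullMeasurableSet_eq (h : IsTHChannel μ En N₀ S b n)
    (z : Matrix (Fin N) (Fin K) ℝ) : NullMeasurableSet {ω | S ω = z} μ := by
  rw [setOf_eq_preimage_cols]
  exact h.aemeasurable_cols.nullMeasurable (measurableSet_singleton _)

theorem IsTHChannel.measure_eq [IsProbabilityMeasure μ]
    (h : IsTHChannel μ En N₀ S b n) (z : Matrix (Fin N) (Fin K) ℝ) :
    μ {ω | S ω = z} = ∏ k, uniformOn (thSequences N) {z.col k} := by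
  have hm := (iIndepFun_iff_map_fun_eq_pi_map
    (fun k => (h.law_col k).aemeasurable)).mp h.indep_col
  rw [setOf_eq_preimage_cols, ← Measure.map_apply_of_aemeasurable h.aemeasurable_cols
    (measurableSet_singleton _), hm, Measure.pi_singleton]
  simp_rw [(h.law_col _).map_eq]

theorem IsTHChannel.measure_eq_thMatrix [IsProbabilityMeasure μ] (h : IsTHChannel μ En N₀ S b n)
    (p : Fin K → Fin N × Bool) :
    μ {ω | S ω = thMatrix p} = (((2 * N : ℕ) : ℝ≥0∞)⁻¹) ^ K := by
  rw [h.measure_eq]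
  simp_rw [thMatrix_col, uniformOn_thSequences_singleton]
  simp

theorem IsTHChannel.measure_eq_of_notMem_range [IsProbabilityMeasure μ] (h : IsTHChannel μ En N₀ S b n)
    {z : Matrix (Fin N) (Fin K) ℝ} (hz : z ∉ Set.range (thMatrix (N := N) (K := K))) :
    μ {ω | S ω = z} = 0 := by
  have : ¬ ∀ k, z.col k ∈ thSequences N := fun hk => hz (mem_range_thMatrix hk)
  push Not at this
  obtain ⟨k, hk⟩ := this
  rw [h.measure_eq]
  exact Finset.prod_eq_zero (Finset.mem_univ k) (uniformOn_thSequences_singleton_of_notMem hk)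

theorem IsTHChannel.map_input_noise [IsProbabilityMeasure μ] (h : IsTHChannel μ En N₀ S b n) :
    μ.map (fun ω => (b ω, n ω)) = (Measure.pi fun _ : Fin K => complexGaussian En).prod
      (Measure.pi fun _ : Fin N => complexGaussian N₀) := by
  rw [(indepFun_iff_map_prod_eq_prod_map_map h.law_input.aemeasurable
    h.law_noise.aemeasurable).mp h.indep_input_noise, h.law_input.map_eq, h.law_noise.map_eq]

/-- Independence of `S` from `(b, n)` lets the probability of the conditioning event cancel. The
event is known only to be null-measurable, since `S` has almost everywhere measurable columns. -/
theorem IsTHChannel.cond_map_input_noise [IsProbabilityMeasure μ]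
    (h : IsTHChannel μ En N₀ S b n)
    {z : Matrix (Fin N) (Fin K) ℝ} (hz : μ {ω | S ω = z} ≠ 0) :
    (μ[|{ω | S ω = z}]).map (fun ω => (b ω, n ω)) =
      (Measure.pi fun _ : Fin K => complexGaussian En).prod
        (Measure.pi fun _ : Fin N => complexGaussian N₀) := by
  have hbn : AEMeasurable (fun ω => (b ω, n ω)) μ :=
    h.law_input.aemeasurable.prodMk h.law_noise.aemeasurable
  rw [← h.map_input_noise]
  ext T hT
  rw [Measure.map_apply_of_aemeasurable (hbn.mono_ac cond_absolutelyContinuous) hT,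
    Measure.map_apply_of_aemeasurable hbn hT, ProbabilityTheory.cond, Measure.smul_apply,
    Measure.restrict_apply₀' (h.nullMeasurableSet_eq z), Set.inter_comm]
  nth_rewrite 2 [setOf_eq_preimage_cols]
  rw [h.indep_spreading.measure_inter_preimage_eq_mul _ _ (measurableSet_singleton _) hT,
    ← setOf_eq_preimage_cols, smul_eq_mul, ← mul_assoc,
    ENNReal.inv_mul_cancel hz (measure_ne_top _ _), one_mul]

theorem IsTHChannel.ae_cond_eq (h : IsTHChannel μ En N₀ S b n) (z : Matrix (Fin N) (Fin K) ℝ) :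
    ∀ᵐ ω ∂(μ[|{ω | S ω = z}]), S ω = z := by
  rw [ProbabilityTheory.cond]
  exact Measure.ae_smul_measure (ae_restrict_mem₀ (h.nullMeasurableSet_eq z)) _

end Channel

/-! ### The scalar channel of one user and its rate given the spreading matrix -/

theorem receiver_output_eq {N K : ℕ} (V : Matrix (Fin K) (Fin N) ℝ) (z : Matrix (Fin N) (Fin K) ℝ)
    (b : Fin K → ℂ) (n : Fin N → ℂ) (u : Fin K) :
    (V.map Complex.ofReal *ᵥ received z b n) u =
      ∑ j, (((V * z) u j : ℝ) : ℂ) * b j + ∑ i, ((V u i : ℝ) : ℂ) * n i := by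
  have hm : V.map Complex.ofReal * z.map Complex.ofReal = (V * z).map Complex.ofReal :=
    (Matrix.map_mul (f := Complex.ofRealHom)).symm
  rw [received, Matrix.mulVec_add, Matrix.mulVec_mulVec, hm]
  rfl

/-- The number of other users whose pulse lies in the chip used by user `u`. -/
def interferers {N M : ℕ} (p : Fin (M + 1) → Fin N × Bool) (u : Fin (M + 1)) : ℕ :=
  (Finset.univ.filter fun j : Fin M => (p (u.succAbove j)).1 = (p u).1).card

/-- Spectral efficiency in bits of a Gaussian channel with `j` interferers at equal power. -/
noncomputable def interferedRate (γ : ℝ) (j : ℕ) : ℝ := Real.logb 2 (1 + γ / (j * γ + 1))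

/-- Only the chip of user `u` contributes, and squaring removes the polarities. The case `j = u`
supplies the gain of the wanted signal. -/
theorem matched_cross_correlation {N K : ℕ} {V : Matrix (Fin K) (Fin N) ℝ}
    {p : Fin K → Fin N × Bool} {u : Fin K} {c : ℝ} (hV : ∀ i, V u i = c * thSeq (p u) i)
    (j : Fin K) : ((V * thMatrix p) u j) ^ 2 = if (p j).1 = (p u).1 then c ^ 2 else 0 := by
  rw [Matrix.mul_apply, Finset.sum_eq_single (p u).1]
  · rw [hV, thMatrix_apply, mul_pow, mul_pow, thSeq_self_sq]
    split_ifs with h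
    · rw [← h, thSeq_self_sq]; ring
    · rw [thSeq_of_ne (Ne.symm h)]; ring
  · intro i _ hi
    rw [hV, thSeq_of_ne hi]; ring
  · simp

theorem matched_noise_gain {N K : ℕ} {V : Matrix (Fin K) (Fin N) ℝ}
    {p : Fin K → Fin N × Bool} {u : Fin K} {c : ℝ} (hV : ∀ i, V u i = c * thSeq (p u) i) :
    ∑ i, (V u i) ^ 2 = c ^ 2 := by
  rw [Finset.sum_eq_single (p u).1]
  · rw [hV, mul_pow, thSeq_self_sq, mul_one]
  · intro i _ hi
    rw [hV, thSeq_of_ne hi]; ring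
  · simp

theorem matched_interference {N M : ℕ} {V : Matrix (Fin (M + 1)) (Fin N) ℝ}
    {p : Fin (M + 1) → Fin N × Bool} {u : Fin (M + 1)} {c : ℝ}
    (hV : ∀ i, V u i = c * thSeq (p u) i) :
    ∑ j, ((V * thMatrix p) u (u.succAbove j)) ^ 2 = interferers p u * c ^ 2 := by
  simp_rw [matched_cross_correlation hV]
  rw [← Finset.sum_filter, Finset.sum_const, nsmul_eq_mul, interferers]

theorem IsTHChannel.map_cond_eq_channelLaw {Ω : Type*} [MeasurableSpace Ω] {μ : Measure Ω}
    [IsProbabilityMeasure μ] {N M : ℕ} {En N₀ : ℝ≥0} {S : Ω → Matrix (Fin N) (Fin (M + 1)) ℝ}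
    {b : Ω → Fin (M + 1) → ℂ} {n : Ω → Fin N → ℂ} (h : IsTHChannel μ En N₀ S b n)
    (W : Matrix (Fin N) (Fin (M + 1)) ℝ → Matrix (Fin (M + 1)) (Fin N) ℝ)
    (u : Fin (M + 1)) {z : Matrix (Fin N) (Fin (M + 1)) ℝ} (hz : μ {ω | S ω = z} ≠ 0) :
    HasLaw (fun ω => (b ω u,
        ((W (S ω)).map Complex.ofReal *ᵥ received (S ω) (b ω) (n ω)) u))
      (channelLaw En ((W z * z) u u) (En * ∑ j, ((W z * z) u (u.succAbove j)).nnabs ^ 2 +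
        N₀ * ∑ i, (W z u i).nnabs ^ 2)) (μ[|{ω | S ω = z}]) := by
  have hbn : AEMeasurable (fun ω => (b ω, n ω)) (μ[|{ω | S ω = z}]) :=
    (h.law_input.aemeasurable.prodMk h.law_noise.aemeasurable).mono_ac cond_absolutelyContinuous
  have hF : Measurable (fun q : (Fin (M + 1) → ℂ) × (Fin N → ℂ) =>
      (q.1 u, ∑ j, (((W z * z) u j : ℝ) : ℂ) * q.1 j + ∑ i, ((W z u i : ℝ) : ℂ) * q.2 i)) := by
    fun_prop
  have hlaw := map_linear_statistic_eq_channelLaw En N₀ u (fun j => (W z * z) u j)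
    (fun i => W z u i)
  rw [← h.cond_map_input_noise hz, AEMeasurable.map_map_of_aemeasurable hF.aemeasurable hbn]
    at hlaw
  refine HasLaw.congr ⟨hF.comp_aemeasurable hbn, hlaw⟩ ?_
  filter_upwards [h.ae_cond_eq z] with ω hω
  rw [hω, receiver_output_eq]
  rfl

theorem IsTHChannel.mutualInfo_cond {Ω : Type*} [MeasurableSpace Ω] {μ : Measure Ω}
    [IsProbabilityMeasure μ] {N M : ℕ} {En N₀ : ℝ≥0} {S : Ω → Matrix (Fin N) (Fin (M + 1)) ℝ}
    {b : Ω → Fin (M + 1) → ℂ} {n : Ω → Fin N → ℂ} (h : IsTHChannel μ En N₀ S b n) (hN₀ : 0 < N₀)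
    {W : Matrix (Fin N) (Fin (M + 1)) ℝ → Matrix (Fin (M + 1)) (Fin N) ℝ}
    (hW : IsMatchedUpToScale W) (u : Fin (M + 1)) (p : Fin (M + 1) → Fin N × Bool)
    (hp : μ {ω | S ω = thMatrix p} ≠ 0) :
    mutualInfo (fun ω => b ω u)
      (fun ω => ((W (S ω)).map Complex.ofReal *ᵥ received (S ω) (b ω) (n ω)) u)
      (μ[|{ω | S ω = thMatrix p}]) =
      ENNReal.ofReal (interferedRate (En / N₀) (interferers p u)) := by
  obtain ⟨c, hc, hV⟩ := hW p u
  have hlaw := h.map_cond_eq_channelLaw W u hp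
  generalize hw : En * ∑ j, ((W (thMatrix p) * thMatrix p) u (u.succAbove j)).nnabs ^ 2 +
    N₀ * ∑ i, (W (thMatrix p) u i).nnabs ^ 2 = w at hlaw
  have hwr : (w : ℝ) = En * (interferers p u * c ^ 2) + N₀ * c ^ 2 := by
    rw [← matched_interference hV, ← matched_noise_gain hV, ← hw]
    simp [sq_abs]
  have hN₀' : (0 : ℝ) < N₀ := hN₀
  have hEn : (0 : ℝ) ≤ En := En.2
  -- The noise part `N₀ * c ^ 2` alone is positive, because the scale `c` is nonzero.
  have hw0 : w ≠ 0 := by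
    have : (0 : ℝ) < w := by rw [hwr]; positivity
    exact_mod_cast this.ne'
  rw [mutualInfo_of_map_eq_channelLaw hlaw.aemeasurable.fst hlaw.aemeasurable.snd hw0
    hlaw.map_eq, interferedRate, matched_cross_correlation hV, if_pos rfl, hwr]
  -- The common factor `c ^ 2` of signal and disturbance cancels: the rate is independent of the
  -- receiver.
  congr 3
  field_simp

theorem IsTHChannel.userInfo_eq_sum {Ω : Type*} [MeasurableSpace Ω] {μ : Measure Ω}
    [IsProbabilityMeasure μ] {N M : ℕ} {En N₀ : ℝ≥0} {S : Ω → Matrix (Fin N) (Fin (M + 1)) ℝ}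
    {b : Ω → Fin (M + 1) → ℂ} {n : Ω → Fin N → ℂ} (h : IsTHChannel μ En N₀ S b n) (hN₀ : 0 < N₀)
    {W : Matrix (Fin N) (Fin (M + 1)) ℝ → Matrix (Fin (M + 1)) (Fin N) ℝ}
    (hW : IsMatchedUpToScale W) (u : Fin (M + 1)) :
    userInfo μ W S b n u = ∑ p : Fin (M + 1) → Fin N × Bool, (((2 * N : ℕ) : ℝ≥0∞)⁻¹) ^ (M + 1) *
      ENNReal.ofReal (interferedRate (En / N₀) (interferers p u)) := by
  -- The sum over all real matrices is supported on the range of `thMatrix`; the other matrices have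
  -- probability zero.
  rw [userInfo, condMutualInfo, ← thMatrix_injective.tsum_eq, tsum_fintype]
  · refine Finset.sum_congr rfl fun p _ => ?_
    have hp := h.measure_eq_thMatrix p
    rw [h.mutualInfo_cond hN₀ hW u p, hp]
    rw [hp]
    exact pow_ne_zero _ (ENNReal.inv_ne_zero.mpr (ENNReal.natCast_ne_top _))
  · intro z hz
    by_contra hn
    exact hz (by simp only [h.measure_eq_of_notMem_range hn, zero_mul])

/-! ### The binomial law of the number of interferers -/

/-- Once the set of coordinates satisfying `P` is prescribed, the coordinates are chosen
independently, so the fibre is a product of finite sets. -/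
theorem card_filter_fiber_eq {X : Type*} [Fintype X] (P : X → Prop) [DecidablePred P] {M : ℕ}
    (A : Finset (Fin M)) :
    (Finset.univ.filter fun g : Fin M → X => (Finset.univ.filter fun j => P (g j)) = A).card =
      (Finset.univ.filter P).card ^ A.card *
        (Finset.univ.filter fun x => ¬ P x).card ^ (M - A.card) := by
  classical
  have h : (Finset.univ.filter fun g : Fin M → X => (Finset.univ.filter fun j => P (g j)) = A) =
      Fintype.piFinset (fun j => if j ∈ A then Finset.univ.filter P
        else Finset.univ.filter fun x => ¬ P x) := by
    ext g
    simp only [Finset.mem_filter, Finset.mem_univ, true_and, Fintype.mem_piFinset,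
      Finset.ext_iff]
    refine forall_congr' fun j => ?_
    by_cases hj : j ∈ A <;> simp [hj]
  rw [h, Fintype.card_piFinset]
  simp only [apply_ite Finset.card]
  rw [Finset.prod_ite, Finset.prod_const, Finset.prod_const]
  congr 2
  · simp
  · rw [Finset.filter_not, Finset.card_sdiff]
    simp

theorem sum_apply_card_filter {X : Type*} [Fintype X] (P : X → Prop) [DecidablePred P] (M : ℕ)
    (F : ℕ → ℝ) :
    ∑ g : Fin M → X, F (Finset.univ.filter fun j => P (g j)).card =
      ∑ k ∈ Finset.range (M + 1), M.choose k * ((Finset.univ.filter P).card ^ k *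
        (Finset.univ.filter fun x => ¬ P x).card ^ (M - k) * F k) := by
  classical
  rw [← Finset.sum_fiberwise (s := Finset.univ)
    (g := fun g : Fin M → X => Finset.univ.filter fun j => P (g j))]
  have h : ∀ A : Finset (Fin M),
      ∑ g : Fin M → X with (Finset.univ.filter fun j => P (g j)) = A,
        F (Finset.univ.filter fun j => P (g j)).card =
      ((Finset.univ.filter P).card ^ A.card *
        (Finset.univ.filter fun x => ¬ P x).card ^ (M - A.card) * F A.card : ℝ) := by
    intro A
    rw [Finset.sum_congr rfl (g := fun _ => F A.card)
      (fun g hg => by rw [(Finset.mem_filter.mp hg).2]), Finset.sum_const, card_filter_fiber_eq,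
      nsmul_eq_mul]
    push_cast
    ring
  simp_rw [h]
  rw [← Finset.powerset_univ, Finset.sum_powerset_apply_card (fun k =>
    ((Finset.univ.filter P).card ^ k *
        (Finset.univ.filter fun x => ¬ P x).card ^ (M - k) * F k : ℝ))]
  simp [nsmul_eq_mul]

/-- For each of the `2 * N` choices for user `u`, every other user has `2` choices in the same chip
(the two polarities) and `2 * (N - 1)` elsewhere. -/
theorem sum_interferers {N M : ℕ} (u : Fin (M + 1)) (F : ℕ → ℝ) :
    ∑ p : Fin (M + 1) → Fin N × Bool, F (interferers p u) =
      (2 * N) * ∑ k ∈ Finset.range (M + 1),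
        M.choose k * (2 ^ k * ((2 * (N - 1) : ℕ) : ℝ) ^ (M - k) * F k) := by
  rw [← (Fin.insertNthEquiv (fun _ : Fin (M + 1) => Fin N × Bool) u).sum_comp,
    Fintype.sum_prod_type]
  have h : ∀ q : Fin N × Bool, ∑ g : Fin M → Fin N × Bool,
      F (interferers (Fin.insertNthEquiv (fun _ : Fin (M + 1) => Fin N × Bool) u (q, g)) u) =
      ∑ k ∈ Finset.range (M + 1),
        M.choose k * (2 ^ k * ((2 * (N - 1) : ℕ) : ℝ) ^ (M - k) * F k) := by
    intro q
    have h1 : (Finset.univ.filter fun x : Fin N × Bool => x.1 = q.1).card = 2 := by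
      have : (Finset.univ.filter fun x : Fin N × Bool => x.1 = q.1) =
          {q.1} ×ˢ (Finset.univ : Finset Bool) := by
        ext x
        simp only [Finset.mem_filter, Finset.mem_product, Finset.mem_singleton,
          Finset.mem_univ, true_and, and_true]
      rw [this, Finset.card_product]; simp
    have h2 : (Finset.univ.filter fun x : Fin N × Bool => ¬ x.1 = q.1).card = 2 * (N - 1) := by
      have : (Finset.univ.filter fun x : Fin N × Bool => ¬ x.1 = q.1) =
          ({q.1}ᶜ : Finset (Fin N)) ×ˢ (Finset.univ : Finset Bool) := by ext x; simp
      rw [this, Finset.card_product, Finset.card_compl]; simp [mul_comm]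
    have := sum_apply_card_filter (fun x : Fin N × Bool => x.1 = q.1) M F
    rw [h1, h2] at this
    simpa [interferers] using this
  simp_rw [h]
  rw [Finset.sum_const, nsmul_eq_mul]
  simp [mul_comm]

theorem interferedRate_nonneg {γ : ℝ} (hγ : 0 ≤ γ) (j : ℕ) : 0 ≤ interferedRate γ j :=
  Real.logb_nonneg one_lt_two (by have : 0 ≤ γ / (j * γ + 1) := by positivity
                                  linarith)

theorem interferedRate_le {γ : ℝ} (hγ : 0 ≤ γ) (j : ℕ) :
    interferedRate γ j ≤ Real.logb 2 (1 + γ) := by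
  refine Real.logb_le_logb_of_le one_lt_two (by positivity) ?_
  gcongr
  exact div_le_self hγ (by have : 0 ≤ j * γ := by positivity
                           linarith)

/-- The binomial weight `C(M, k) x ^ k (1 - x) ^ (M - k)`. -/
noncomputable def binomialWeight (M : ℕ) (x : ℝ) (k : ℕ) : ℝ :=
  M.choose k * x ^ k * (1 - x) ^ (M - k)

/-- Normalising the count by `(2 * N) ^ (M + 1)` yields binomial probabilities. The finite sum is
written as a series, whose terms beyond `M` vanish, so that the index set stays fixed in the limit.
-/
theorem IsTHChannel.userInfo_eq_binomial {Ω : Type*} [MeasurableSpace Ω] {μ : Measure Ω}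
    [IsProbabilityMeasure μ] {N M : ℕ} {En N₀ : ℝ≥0} {S : Ω → Matrix (Fin N) (Fin (M + 1)) ℝ}
    {b : Ω → Fin (M + 1) → ℂ} {n : Ω → Fin N → ℂ} (h : IsTHChannel μ En N₀ S b n) (hN : 0 < N)
    (hN₀ : 0 < N₀) {W : Matrix (Fin N) (Fin (M + 1)) ℝ → Matrix (Fin (M + 1)) (Fin N) ℝ}
    (hW : IsMatchedUpToScale W) (u : Fin (M + 1)) :
    userInfo μ W S b n u = ENNReal.ofReal
      (∑' k, binomialWeight M (N : ℝ)⁻¹ k * interferedRate (En / N₀) k) := by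
  have hN' : (0 : ℝ) < N := by exact_mod_cast hN
  have hr : ∀ j, 0 ≤ interferedRate (En / N₀) j := interferedRate_nonneg (by positivity)
  have hc : (((2 * N : ℕ) : ℝ≥0∞)⁻¹) = ENNReal.ofReal ((2 * N : ℝ)⁻¹) := by
    rw [ENNReal.ofReal_inv_of_pos (by positivity), ← ENNReal.ofReal_natCast]
    push_cast
    rfl
  rw [h.userInfo_eq_sum hN₀ hW u, hc, ← Finset.mul_sum,
    ← ENNReal.ofReal_sum_of_nonneg fun p _ => hr (interferers p u),
    ← ENNReal.ofReal_pow (by positivity), ← ENNReal.ofReal_mul (by positivity), sum_interferers,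
    tsum_eq_sum (s := Finset.range (M + 1))]
  · congr 1
    rw [Finset.mul_sum, Finset.mul_sum]
    refine Finset.sum_congr rfl fun k hk => ?_
    have hk' : k ≤ M := Nat.lt_succ_iff.mp (Finset.mem_range.mp hk)
    obtain ⟨l, rfl⟩ := Nat.exists_eq_add_of_le hk'
    have e1 : ((2 * (N - 1) : ℕ) : ℝ) = 2 * N * (1 - (N : ℝ)⁻¹) := by
      rw [Nat.cast_mul, Nat.cast_sub hN]
      push_cast
      field_simp
    rw [binomialWeight, e1, Nat.add_sub_cancel_left, mul_pow, inv_pow, inv_pow, pow_succ, pow_add,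
      mul_pow, mul_pow]
    field_simp
  · intro k hk
    rw [binomialWeight, Nat.choose_eq_zero_of_lt (by simpa using hk)]
    simp

/-! ### The Poisson limit -/

/-- Write the power as `((1 - 1/N)^N)^(M/N)` with a real outer exponent: the base tends to `exp
(-1)` and the exponent to `β`. -/
theorem tendsto_one_sub_inv_pow {N M : ℕ → ℕ} {β : ℝ} (hN : Tendsto N atTop atTop)
    (hM : Tendsto (fun m => (M m : ℝ) / N m) atTop (𝓝 β)) :
    Tendsto (fun m => (1 - (N m : ℝ)⁻¹) ^ M m) atTop (𝓝 (Real.exp (-β))) := by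
  have h1 : Tendsto (fun m => (1 + -1 / (N m : ℝ)) ^ N m) atTop (𝓝 (Real.exp (-1))) :=
    (Real.tendsto_one_add_div_pow_exp (-1)).comp hN
  have h2 := h1.rpow hM (Or.inl (Real.exp_pos _).ne')
  rw [← Real.exp_mul, neg_one_mul] at h2
  refine h2.congr' ?_
  filter_upwards [hN.eventually_ge_atTop 1] with m hm
  have hm' : (1 : ℝ) ≤ N m := by exact_mod_cast hm
  have h0 : 0 ≤ 1 - (N m : ℝ)⁻¹ := sub_nonneg.mpr (inv_le_one_of_one_le₀ hm')
  have e : 1 + -1 / (N m : ℝ) = 1 - (N m : ℝ)⁻¹ := by ring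
  rw [e, ← Real.rpow_natCast, ← Real.rpow_mul h0, mul_div_cancel₀ _ (by positivity),
    Real.rpow_natCast]

theorem tendsto_binomialWeight {N M : ℕ → ℕ} {β : ℝ} (hN : Tendsto N atTop atTop)
    (hMtop : Tendsto M atTop atTop) (hM : Tendsto (fun m => (M m : ℝ) / N m) atTop (𝓝 β))
    (k : ℕ) :
    Tendsto (fun m => binomialWeight (M m) (N m : ℝ)⁻¹ k) atTop
      (𝓝 (β ^ k * Real.exp (-β) / k.factorial)) := by
  have hinv : Tendsto (fun m => (N m : ℝ)⁻¹) atTop (𝓝 0) :=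
    tendsto_inv_atTop_zero.comp (tendsto_natCast_atTop_atTop.comp hN)
  have h1 : Tendsto (fun m => (M m).choose k * ((N m : ℝ)⁻¹) ^ k) atTop
      (𝓝 (β ^ k / k.factorial)) := by
    -- For fixed `k`, the binomial coefficient is asymptotic to `M ^ k / k!`, leaving `(M / N) ^ k /
    -- k!`.
    have he := ((isEquivalent_choose k).comp_tendsto hMtop).mul
      (Asymptotics.IsEquivalent.refl (u := fun m => ((N m : ℝ)⁻¹) ^ k))
    refine he.symm.tendsto_nhds ?_
    refine ((hM.pow k).div_const (k.factorial : ℝ)).congr fun m => ?_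
    simp only [Pi.mul_apply, Function.comp_apply, div_pow, inv_pow]
    ring
  have h2 : Tendsto (fun m => (1 - (N m : ℝ)⁻¹) ^ (M m - k)) atTop (𝓝 (Real.exp (-β))) := by
    have hd : Tendsto (fun m => ((M m - k : ℕ) : ℝ) / N m) atTop (𝓝 β) := by
      have := hM.sub (hinv.const_mul (k : ℝ))
      rw [mul_zero, sub_zero] at this
      refine this.congr' ?_
      filter_upwards [hMtop.eventually_ge_atTop k] with m hm
      rw [Nat.cast_sub hm]
      ring
    exact tendsto_one_sub_inv_pow hN hd
  rw [mul_div_right_comm]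
  exact h1.mul h2

theorem binomialWeight_nonneg {M : ℕ} {x : ℝ} (h0 : 0 ≤ x) (h1 : x ≤ 1) (k : ℕ) :
    0 ≤ binomialWeight M x k := by
  have := sub_nonneg.mpr h1
  unfold binomialWeight
  positivity

/-- With `x = 1 / N` the bound depends only on the ratio `M / N`, which gives domination uniform in
the system size. -/
theorem binomialWeight_le {M : ℕ} {x : ℝ} (h0 : 0 ≤ x) (h1 : x ≤ 1) (k : ℕ) :
    binomialWeight M x k ≤ (M * x) ^ k / k.factorial := by
  have h2 := sub_nonneg.mpr h1
  have h3 : (1 - x) ^ (M - k) ≤ 1 := pow_le_one₀ h2 (by linarith)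
  calc binomialWeight M x k ≤ M.choose k * x ^ k := mul_le_of_le_one_right (by positivity) h3
    _ ≤ (M : ℝ) ^ k / k.factorial * x ^ k := by gcongr; exact Nat.choose_le_pow_div k M
    _ = (M * x) ^ k / k.factorial := by rw [mul_pow]; ring

theorem poissonTerm_eq (β γ : ℝ) (k : ℕ) :
    poissonTerm β γ k = β ^ k * Real.exp (-β) / k.factorial * interferedRate γ k := rfl

theorem summable_poissonTerm {β γ : ℝ} (hβ : 0 ≤ β) (hγ : 0 ≤ γ) :
    Summable (poissonTerm β γ) := by
  refine Summable.of_nonneg_of_le (fun k => ?_) (fun k => ?_)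
    (((Real.summable_pow_div_factorial β).mul_right (Real.exp (-β))).mul_right
      (Real.logb 2 (1 + γ)))
  · have := interferedRate_nonneg hγ k
    rw [poissonTerm_eq]
    positivity
  · rw [poissonTerm_eq, mul_div_right_comm]
    gcongr
    exact interferedRate_le hγ k

theorem tendsto_tsum_binomialWeight {N M : ℕ → ℕ} {β γ : ℝ} (hβ : 0 ≤ β) (hγ : 0 ≤ γ)
    (hN : Tendsto N atTop atTop) (hMtop : Tendsto M atTop atTop)
    (hM : Tendsto (fun m => (M m : ℝ) / N m) atTop (𝓝 β)) :
    Tendsto (fun m => ∑' k, binomialWeight (M m) (N m : ℝ)⁻¹ k * interferedRate γ k) atTop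
      (𝓝 (∑' k, poissonTerm β γ k)) := by
  refine tendsto_tsum_of_dominated_convergence
    -- Any constant above `β` would do: eventually `M / N ≤ β + 1`. The factor `logb 2 (1 + γ)` is
    -- the interference-free rate.
    ((Real.summable_pow_div_factorial (β + 1)).mul_right (Real.logb 2 (1 + γ)))
    (fun k => (tendsto_binomialWeight hN hMtop hM k).mul_const _) ?_
  filter_upwards [hN.eventually_ge_atTop 1, hM.eventually_le_const (lt_add_one β)] with m hm hle k
  have hm' : (1 : ℝ) ≤ N m := by exact_mod_cast hm
  have h0 : 0 ≤ (N m : ℝ)⁻¹ := by positivity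
  have h1 : (N m : ℝ)⁻¹ ≤ 1 := inv_le_one_of_one_le₀ hm'
  have hw := binomialWeight_nonneg (M := M m) h0 h1 k
  have hr := interferedRate_nonneg hγ k
  rw [Real.norm_of_nonneg (mul_nonneg hw hr)]
  refine mul_le_mul ((binomialWeight_le h0 h1 k).trans ?_) (interferedRate_le hγ k) hr
    (by positivity)
  rw [← div_eq_mul_inv]
  gcongr

theorem tendsto_natCast_sub_one_div {N K : ℕ → ℕ} {β : ℝ} (hN : Tendsto N atTop atTop)
    (hK : Tendsto (fun m => (K m : ℝ) / N m) atTop (𝓝 β)) (hpos : ∀ m, 0 < K m) :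
    Tendsto (fun m => ((K m - 1 : ℕ) : ℝ) / N m) atTop (𝓝 β) := by
  have hinv : Tendsto (fun m => (N m : ℝ)⁻¹) atTop (𝓝 0) :=
    tendsto_inv_atTop_zero.comp (tendsto_natCast_atTop_atTop.comp hN)
  have := hK.sub hinv
  rw [sub_zero] at this
  refine this.congr fun m => ?_
  rw [Nat.cast_sub (hpos m)]
  push_cast
  ring

/-- The positive limit of the ratio forces `M` to grow with `N`; this feeds the asymptotics of the
binomial coefficients. -/
theorem tendsto_atTop_of_tendsto_div {N M : ℕ → ℕ} {β : ℝ} (hβ : 0 < β)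
    (hN : Tendsto N atTop atTop) (hM : Tendsto (fun m => (M m : ℝ) / N m) atTop (𝓝 β)) :
    Tendsto M atTop atTop := by
  have h : Tendsto (fun m => (M m : ℝ) / N m * N m) atTop atTop :=
    hM.pos_mul_atTop hβ (tendsto_natCast_atTop_atTop.comp hN)
  rw [← tendsto_natCast_atTop_iff (R := ℝ)]
  refine h.congr' ?_
  filter_upwards [hN.eventually_ge_atTop 1] with m hm
  exact div_mul_cancel₀ _ (by positivity)

theorem IsTHChannel.userInfo_eq_binomial_sub_one {Ω : Type*} [MeasurableSpace Ω] {μ : Measure Ω}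
    [IsProbabilityMeasure μ] {N K : ℕ} {En N₀ : ℝ≥0} {S : Ω → Matrix (Fin N) (Fin K) ℝ}
    {b : Ω → Fin K → ℂ} {n : Ω → Fin N → ℂ} (h : IsTHChannel μ En N₀ S b n) (hN : 0 < N)
    (hN₀ : 0 < N₀) {W : Matrix (Fin N) (Fin K) ℝ → Matrix (Fin K) (Fin N) ℝ}
    (hW : IsMatchedUpToScale W) (u : Fin K) :
    userInfo μ W S b n u = ENNReal.ofReal
      (∑' k, binomialWeight (K - 1) (N : ℝ)⁻¹ k * interferedRate (En / N₀) k) := by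
  cases K with
  -- A user exists, so `K` is positive and the truncated `K - 1` is the true number of other users.
  | zero => exact u.elim0
  | succ M => exact h.userInfo_eq_binomial hN hN₀ hW u

/-- The large-system limit for any receiver that is a scaled matched filter on time-hopping
matrices. -/
theorem tendsto_userInfo {β : ℝ} (hβ : 0 < β) {En N₀ : ℝ≥0} (hN₀ : 0 < N₀)
    {N K : ℕ → ℕ} (hN : Tendsto N atTop atTop)
    (hK : Tendsto (fun m => (K m : ℝ) / (N m : ℝ)) atTop (𝓝 β))
    {Ω : ℕ → Type*} [∀ m, MeasurableSpace (Ω m)]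
    {μ : ∀ m, Measure (Ω m)} [∀ m, IsProbabilityMeasure (μ m)]
    {S : ∀ m, Ω m → Matrix (Fin (N m)) (Fin (K m)) ℝ}
    {b : ∀ m, Ω m → Fin (K m) → ℂ} {n : ∀ m, Ω m → Fin (N m) → ℂ}
    (hch : ∀ m, IsTHChannel (μ m) En N₀ (S m) (b m) (n m)) (u : ∀ m, Fin (K m))
    {W : ∀ m, Matrix (Fin (N m)) (Fin (K m)) ℝ → Matrix (Fin (K m)) (Fin (N m)) ℝ}
    (hW : ∀ m, IsMatchedUpToScale (W m)) :
    Tendsto (fun m => ENNReal.ofReal β * userInfo (μ m) (W m) (S m) (b m) (n m) (u m)) atTop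
      (𝓝 (ENNReal.ofReal (β * ∑' k, poissonTerm β (En / N₀) k))) := by
  have hM := tendsto_natCast_sub_one_div hN hK fun m => (Nat.zero_le _).trans_lt (u m).2
  have h := tendsto_tsum_binomialWeight hβ.le (γ := En / N₀) (by positivity) hN
    (tendsto_atTop_of_tendsto_div hβ hN hM) hM
  refine (ENNReal.tendsto_ofReal (h.const_mul β)).congr' ?_
  filter_upwards [hN.eventually_ge_atTop 1] with m hm
  rw [(hch m).userInfo_eq_binomial_sub_one hm hN₀ (hW m) (u m), ENNReal.ofReal_mul hβ.le]

end THCDMA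

theorem theorem5
    (β : ℝ) (hβ : 0 < β) (En N₀ : ℝ≥0) (hEn : 0 < En) (hN₀ : 0 < N₀)
    (γ : ℝ) (hγ : γ = (En : ℝ) / (N₀ : ℝ))
    -- the large-system limit: `N → ∞` and `K / N → β`
    (N K : ℕ → ℕ) (hN : Tendsto N atTop atTop)
    (hK : Tendsto (fun m => (K m : ℝ) / (N m : ℝ)) atTop (𝓝 β))
    {Ω : ℕ → Type*} [∀ m, MeasurableSpace (Ω m)]
    (μ : ∀ m, Measure (Ω m)) [∀ m, IsProbabilityMeasure (μ m)]
    (S : ∀ m, Ω m → Matrix (Fin (N m)) (Fin (K m)) ℝ)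
    (b : ∀ m, Ω m → Fin (K m) → ℂ) (n : ∀ m, Ω m → Fin (N m) → ℂ)
    (hch : ∀ m, THCDMA.IsTHChannel (μ m) En N₀ (S m) (b m) (n m))
    -- the user under consideration
    (u : ∀ m, Fin (K m)) :
    Summable (THCDMA.poissonTerm β γ) ∧
    -- decorrelators
    Tendsto (fun m => ENNReal.ofReal β *
        THCDMA.userInfo (μ m) THCDMA.decorrelator (S m) (b m) (n m) (u m)) atTop
      (𝓝 (ENNReal.ofReal (β * ∑' k, THCDMA.poissonTerm β γ k))) ∧
    -- MMSE filters
    Tendsto (fun m => ENNReal.ofReal β *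
        THCDMA.userInfo (μ m) (THCDMA.mmse γ) (S m) (b m) (n m) (u m)) atTop
      (𝓝 (ENNReal.ofReal (β * ∑' k, THCDMA.poissonTerm β γ k))) ∧
    -- the same value for every regularization parameter
    (∀ α : ℝ, 0 < α →
      Tendsto (fun m => ENNReal.ofReal β *
          THCDMA.userInfo (μ m) (THCDMA.linearReceiver α) (S m) (b m) (n m) (u m)) atTop
        (𝓝 (ENNReal.ofReal (β * ∑' k, THCDMA.poissonTerm β γ k)))) ∧
    -- the same value for single-user matched filters
    Tendsto (fun m => ENNReal.ofReal β *
        THCDMA.userInfo (μ m) THCDMA.sumf (S m) (b m) (n m) (u m)) atTop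
      (𝓝 (ENNReal.ofReal (β * ∑' k, THCDMA.poissonTerm β γ k))) := by
  have hγ0 : 0 < γ := hγ ▸ div_pos (NNReal.coe_pos.mpr hEn) (NNReal.coe_pos.mpr hN₀)
  have hlin : ∀ α : ℝ, 0 < α →
      Tendsto (fun m => ENNReal.ofReal β *
          THCDMA.userInfo (μ m) (THCDMA.linearReceiver α) (S m) (b m) (n m) (u m)) atTop
        (𝓝 (ENNReal.ofReal (β * ∑' k, THCDMA.poissonTerm β γ k))) := fun α hα =>
    hγ ▸ THCDMA.tendsto_userInfo hβ hN₀ hN hK hch u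
      fun _ => THCDMA.isMatchedUpToScale_linearReceiver hα
  exact ⟨THCDMA.summable_poissonTerm hβ.le hγ0.le,
    hγ ▸ THCDMA.tendsto_userInfo hβ hN₀ hN hK hch u
      fun _ => THCDMA.isMatchedUpToScale_decorrelator,
    -- `mmse γ` is by definition `linearReceiver (1 / γ)`, so the MMSE case is an instance of the
    -- general one.
    hlin (1 / γ) (one_div_pos.mpr hγ0), hlin,
    hγ ▸ THCDMA.tendsto_userInfo hβ hN₀ hN hK hch u
      fun _ => THCDMA.isMatchedUpToScale_sumf⟩
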